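/- Let $A \neq 0$ be a unital $C^*$-algebra that has no tracial state, i.e. there is no positive linear functional $\tau : A \to \mathbb{C}$ with $\tau(1)=1$ and $\tau(ab)=\tau(ba)$ for all $a,b\in A$. Let $\mathbb{F}_\infty$ be the free group on countably infinitely many generators, and let $C_r^*(\mathbb{F}_\infty)\subset B(\ell^2(\mathbb{F}_\infty))$ be its reduced $C^*$-algebra, generated by the left translation operators. Then the minimal (spatial) $C^*$-tensor product $A\otimes C_r^*(\mathbb{F}_\infty)$ contains a non-unitary isometry, i.e. an element $v$ with $v^*v=1$ and $vv^*\neq 1$. -/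

import Mathlib

open scoped ComplexOrder TensorProduct InnerProductSpace

noncomputable section

/-! ### States and tracial states -/

/-- The states of a unital C⋆-algebra: the unital positive linear functionals. -/
def CStarState (A : Type*) [CStarAlgebra A] [PartialOrder A] : Type _ :=
  {φ : A →ₚ[ℂ] ℂ // φ 1 = 1}

/-- A tracial state: a state `τ` with `τ (a * b) = τ (b * a)` for all `a` and `b`. -/
def CStarState.IsTracial {A : Type*} [CStarAlgebra A] [PartialOrder A] (τ : CStarState A) : Prop :=
  ∀ a b : A, τ.1 (a * b) = τ.1 (b * a)

/-! ### Direct sums of representations and the universal representation -/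

section DirectSum

variable {ι : Type*} {A : Type*} [CStarAlgebra A] {H : ι → Type*}
  [∀ i, NormedAddCommGroup (H i)] [∀ i, InnerProductSpace ℂ (H i)] [∀ i, CompleteSpace (H i)]

/-- The operator `⊕ᵢ πᵢ(a)` on the Hilbert space direct sum `⊕ᵢ Hᵢ`. -/
def directSumOp (π : ∀ i, A →⋆ₐ[ℂ] (H i →L[ℂ] H i)) (a : A) : lp H 2 →L[ℂ] lp H 2 :=
  lp.mapCLM 2 (fun i => π i a) (norm_nonneg a)
    (fun i => NonUnitalStarAlgHom.norm_apply_le (π i) a)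

theorem directSumOp_apply (π : ∀ i, A →⋆ₐ[ℂ] (H i →L[ℂ] H i)) (a : A) (ξ : lp H 2) (i : ι) :
    directSumOp π a ξ i = π i a (ξ i) := rfl

/-- The direct sum of a family of representations on Hilbert spaces. -/
def directSumRep (π : ∀ i, A →⋆ₐ[ℂ] (H i →L[ℂ] H i)) : A →⋆ₐ[ℂ] (lp H 2 →L[ℂ] lp H 2) where
  toFun := directSumOp π
  map_one' := by ext ξ i; simp [directSumOp_apply]
  map_mul' a b := by ext ξ i; simp [directSumOp_apply]
  map_zero' := by ext ξ i; simp [directSumOp_apply]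
  map_add' a b := by ext ξ i; simp [directSumOp_apply]
  commutes' c := by ext ξ i; simp [directSumOp_apply, Algebra.algebraMap_eq_smul_one]
  map_star' a := by
    refine (ContinuousLinearMap.eq_adjoint_iff _ _).mpr fun ξ η => ?_
    simp only [lp.inner_eq_tsum, directSumOp_apply, map_star,
      ContinuousLinearMap.star_eq_adjoint, ContinuousLinearMap.adjoint_inner_left]

end DirectSum

section Universal

variable (A : Type*) [CStarAlgebra A] [PartialOrder A] [StarOrderedRing A]

/-- The Hilbert space of the universal representation: the direct sum of the
Gelfand–Naimark–Segal spaces of all states. -/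
abbrev UniversalSpace : Type _ := lp (fun φ : CStarState A => φ.1.GNS) 2

/-- The universal representation of a unital C⋆-algebra: the direct sum of the
Gelfand–Naimark–Segal representations of all its states. -/
def universalRep : A →⋆ₐ[ℂ] (UniversalSpace A →L[ℂ] UniversalSpace A) :=
  directSumRep fun φ : CStarState A => φ.1.gnsStarAlgHom

end Universal

/-! ### The spatial (minimal) tensor product -/

section HilbertTensor

variable (H K : Type*) [NormedAddCommGroup H] [InnerProductSpace ℂ H]
  [NormedAddCommGroup K] [InnerProductSpace ℂ K]

/-- The Hilbert space tensor product: the completion of the algebraic tensor product for the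
inner product `⟪x ⊗ y, x' ⊗ y'⟫ = ⟪x, x'⟫ * ⟪y, y'⟫`. -/
def HilbertTensor : Type _ := UniformSpace.Completion (H ⊗[ℂ] K)

instance : NormedAddCommGroup (HilbertTensor H K) :=
  inferInstanceAs (NormedAddCommGroup (UniformSpace.Completion (H ⊗[ℂ] K)))

instance : InnerProductSpace ℂ (HilbertTensor H K) :=
  inferInstanceAs (InnerProductSpace ℂ (UniformSpace.Completion (H ⊗[ℂ] K)))

instance : CompleteSpace (HilbertTensor H K) :=
  inferInstanceAs (CompleteSpace (UniformSpace.Completion (H ⊗[ℂ] K)))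

variable {H K}

/-- The canonical inclusion of the algebraic tensor product, of dense range. -/
def HilbertTensor.of : H ⊗[ℂ] K →ₗᵢ[ℂ] HilbertTensor H K :=
  UniformSpace.Completion.toComplₗᵢ (𝕜 := ℂ) (E := H ⊗[ℂ] K)

theorem HilbertTensor.inner_of (x x' : H) (y y' : K) :
    ⟪HilbertTensor.of (x ⊗ₜ[ℂ] y), HilbertTensor.of (x' ⊗ₜ[ℂ] y')⟫_ℂ = ⟪x, x'⟫_ℂ * ⟪y, y'⟫_ℂ := by
  rw [LinearIsometry.inner_map_map, TensorProduct.inner_tmul]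

theorem HilbertTensor.denseRange_of : DenseRange (HilbertTensor.of (H := H) (K := K)) :=
  UniformSpace.Completion.denseRange_coe

/-- The bounded operator `S ⊗ T` on the Hilbert space tensor product. -/
def tensorOp (S : H →L[ℂ] H) (T : K →L[ℂ] K) : HilbertTensor H K →L[ℂ] HilbertTensor H K :=
  ContinuousLinearMap.completion (TensorProduct.mapL S T)

theorem tensorOp_of (S : H →L[ℂ] H) (T : K →L[ℂ] K) (x : H) (y : K) :
    tensorOp S T (HilbertTensor.of (x ⊗ₜ[ℂ] y)) = HilbertTensor.of (S x ⊗ₜ[ℂ] T y) :=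
  ContinuousLinearMap.completion_apply_coe (TensorProduct.mapL S T) (x ⊗ₜ[ℂ] y)

end HilbertTensor

/-- The C⋆-algebra of operators on `H ⊗ K` generated by the operators `π a ⊗ ρ b`. -/
def spatialTensor {A B H K : Type*} [CStarAlgebra A] [CStarAlgebra B]
    [NormedAddCommGroup H] [InnerProductSpace ℂ H] [CompleteSpace H]
    [NormedAddCommGroup K] [InnerProductSpace ℂ K] [CompleteSpace K]
    (π : A →⋆ₐ[ℂ] (H →L[ℂ] H)) (ρ : B →⋆ₐ[ℂ] (K →L[ℂ] K)) :
    StarSubalgebra ℂ (HilbertTensor H K →L[ℂ] HilbertTensor H K) :=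
  (StarAlgebra.adjoin ℂ
    {T | ∃ (a : A) (b : B), T = tensorOp (π a) (ρ b)}).topologicalClosure

section MinTensor

variable (A B : Type*) [CStarAlgebra A] [PartialOrder A] [StarOrderedRing A]
  [CStarAlgebra B] [PartialOrder B] [StarOrderedRing B]

/-- The spatial (that is, minimal) C⋆-tensor product of two unital C⋆-algebras, realised on the
tensor product of the Hilbert spaces of their universal representations. -/
def MinTensor : Type _ := spatialTensor (universalRep A) (universalRep B)

instance : CStarAlgebra (MinTensor A B) :=
  StarSubalgebra.cstarAlgebra (spatialTensor (universalRep A) (universalRep B))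
    (h_closed := StarSubalgebra.isClosed_topologicalClosure _)

end MinTensor

/-! ### The reduced C⋆-algebra of a discrete group -/

section ReducedGroup

variable (G : Type*) [Group G]

/-- The Hilbert space `ℓ²(G)`. -/
abbrev EllTwo : Type _ := lp (fun _ : G => ℂ) 2

variable {G}

theorem memℓp_translate (g : G) (ξ : EllTwo G) : Memℓp (fun h : G => ξ (g⁻¹ * h)) 2 := by
  have hp : 0 < (2 : ENNReal).toReal := by norm_num
  exact (memℓp_gen_iff hp).mpr
    ((Equiv.mulLeft g⁻¹).summable_iff.mpr ((memℓp_gen_iff hp).mp (lp.memℓp ξ)))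

/-- The left regular representation: `(λ(g) ξ)(h) = ξ(g⁻¹ h)`. -/
def leftRegular (g : G) : EllTwo G →L[ℂ] EllTwo G :=
  LinearIsometry.toContinuousLinearMap
    { toFun := fun ξ => ⟨fun h => ξ (g⁻¹ * h), memℓp_translate g ξ⟩
      map_add' := fun ξ η => rfl
      map_smul' := fun c ξ => rfl
      norm_map' := fun ξ => by
        have hp : 0 < (2 : ENNReal).toReal := by norm_num
        rw [lp.norm_eq_tsum_rpow hp, lp.norm_eq_tsum_rpow hp]
        congr 1
        exact (Equiv.mulLeft g⁻¹).tsum_eq fun h => ‖ξ h‖ ^ (2 : ENNReal).toReal }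

theorem leftRegular_apply (g : G) (ξ : EllTwo G) (h : G) :
    leftRegular g ξ h = ξ (g⁻¹ * h) := rfl

variable (G)

/-- The reduced group C⋆-algebra as an algebra of operators on `ℓ²(G)`: the C⋆-algebra generated
by the left translations. -/
def reducedSubalgebra : StarSubalgebra ℂ (EllTwo G →L[ℂ] EllTwo G) :=
  (StarAlgebra.adjoin ℂ (Set.range (leftRegular (G := G)))).topologicalClosure

/-- The reduced group C⋆-algebra. -/
def ReducedGroupCStar : Type _ := reducedSubalgebra G

instance : CStarAlgebra (ReducedGroupCStar G) :=
  StarSubalgebra.cstarAlgebra (reducedSubalgebra G)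
    (h_closed := StarSubalgebra.isClosed_topologicalClosure _)

/-- The order of a C⋆-algebra, in which the positive elements are the `star x * x`. -/
instance : PartialOrder (ReducedGroupCStar G) := CStarAlgebra.spectralOrder _

instance : StarOrderedRing (ReducedGroupCStar G) := CStarAlgebra.spectralOrderedRing _

end ReducedGroup

end

noncomputable section

/-! ### Hahn–Banach separation and states -/

section States

variable {A : Type*} [CStarAlgebra A] [PartialOrder A] [StarOrderedRing A]

/-! If the real span of the elements `a*a - aa*` avoided the open convex set of elements with
strictly positive real part, Hahn–Banach would give a state whose real part vanishes on that span,
hence a tracial state. So some finite sum satisfies `∑ aᵢ*aᵢ ≥ ∑ aᵢaᵢ* + ε`, and after normalising,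
`∑ aᵢaᵢ* = 1` and `∑ aᵢ*aᵢ ≥ r > 1` (`exists_sum_mul_star_eq_one`).

Take `N` copies of each `aᵢ` and put `T = ∑ aᵢ ⊗ λ(gᵢₖ)` with distinct free generators. Cut each
`λ(g)` according to whether a word starts with `g⁻¹`, so that `T = S + R`. Where no cancellation
occurs the ranges are orthogonal, so `S*S ≥ r(N - 1)`; the cancelling parts have orthogonal
supports, so `RR* ≤ N`. For large `N` the term `S` dominates: `T` is left invertible, and invertible
only if `S` is. But the range of `S` is orthogonal to `H ⊗ δ₁`, so `T` is not invertible
(`exists_leftInvertible_sum_tensorOp`), and polar decomposition gives a non-unitary isometry.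

This computation takes place on `ℓ²` of the free group, whereas `MinTensor` uses universal
representations. Left invertibility of `T` means `T*T ≥ δ`, and positivity in the algebraic tensor
product is independent of the faithful representation of the second factor
(`tensorRep_nonneg_of_injective`), because it can be tested on matrices over that factor. -/

/-- The elements of a C⋆-algebra whose real part is bounded below by a positive scalar. -/
def accretiveSet (A : Type*) [CStarAlgebra A] [PartialOrder A] : Set A :=
  {x | ∃ ε : ℝ, 0 < ε ∧ algebraMap ℝ A ε ≤ x + star x}

theorem isOpen_accretiveSet : IsOpen (accretiveSet A) := by
  refine Metric.isOpen_iff.mpr ?_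
  rintro x ⟨ε, hε, hx⟩
  refine ⟨ε / 4, by positivity, fun y hy => ⟨ε / 2, by positivity, ?_⟩⟩
  rw [mem_ball_iff_norm] at hy
  have hsa : IsSelfAdjoint ((y - x) + star (y - x)) := IsSelfAdjoint.add_star_self _
  have h1 := hsa.neg_algebraMap_norm_le_self
  have h2 : ‖(y - x) + star (y - x)‖ ≤ ε / 2 := by
    refine (norm_add_le _ _).trans ?_
    rw [norm_star]; linarith
  have h3 : algebraMap ℝ A (-(ε / 2)) ≤ (y - x) + star (y - x) := by
    refine le_trans ?_ h1
    rw [← map_neg]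
    exact algebraMap_mono A (by linarith)
  have h4 := add_le_add hx h3
  rw [← map_add] at h4
  convert h4 using 1
  · congr 1; ring
  · rw [star_sub]; abel

theorem convex_accretiveSet : Convex ℝ (accretiveSet A) := by
  rw [convex_iff_forall_pos]
  rintro x ⟨ε, hε, hx⟩ y ⟨δ, hδ, hy⟩ s t hs ht -
  refine ⟨s * ε + t * δ, by positivity, ?_⟩
  have h := add_le_add (smul_le_smul_of_nonneg_left hx hs.le)
    (smul_le_smul_of_nonneg_left hy ht.le)
  convert h using 1
  · simp [Algebra.algebraMap_eq_smul_one, add_smul, mul_smul]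
  · simp only [star_add, star_smul, star_trivial, smul_add]; abel

/-- A real subspace containing no element with strictly positive real part is annihilated by
the real part of some state. -/
theorem exists_state_re_eq_zero (D : Submodule ℝ A) (hD : ∀ d ∈ D, d ∉ accretiveSet A) :
    ∃ φ : CStarState A, ∀ d ∈ D, (φ.1 d).re = 0 := by
  -- The real part of `f` is negative on the accretive set, so `-f` has the sign of a positive
  -- functional; dividing `f` by `f 1` corrects the sign and normalises at once.
  obtain ⟨f, u, hf, hu⟩ := RCLike.geometric_hahn_banach_open (𝕜 := ℂ) convex_accretiveSet
    isOpen_accretiveSet D.convex (Set.disjoint_right.mpr hD)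
  have hu0 : u ≤ 0 := by simpa using hu 0 D.zero_mem
  have hneg : ∀ x ∈ accretiveSet A, (f x).re < 0 := fun x hx => (hf x hx).trans_le hu0
  have hsmul : ∀ (t : ℝ) (x : A), (f (t • x)).re = t * (f x).re := fun t x => by
    rw [← Complex.coe_smul, map_smul]; simp
  have hf0 : ∀ d ∈ D, (f d).re = 0 := by
    intro d hd
    by_contra hne
    -- The factor makes the real part of `f` equal to `u - 1`, below the bound `u`.
    have h := hu _ (D.smul_mem ((u - 1) / (f d).re) hd)
    change u ≤ (f _).re at h
    rw [hsmul, div_mul_cancel₀ _ hne] at h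
    linarith
  have hone : ∀ (ε : ℝ), 0 < ε → ∀ x : A, 0 ≤ x + star x →
      0 < - (f x).re + ε * (-(f 1).re) := by
    intro ε hε x hx
    have h := hneg (x + ε • 1) ⟨ε, hε, by
      have h1 : (0 : A) ≤ ε • 1 := smul_nonneg hε.le zero_le_one
      have h2 := add_le_add hx h1
      rw [zero_add] at h2
      rw [Algebra.algebraMap_eq_smul_one]
      calc ε • (1 : A) ≤ (x + star x + ε • 1) + ε • 1 := le_add_of_nonneg_left (by
            simpa using add_nonneg hx h1)
        _ = _ := by simp only [star_add, star_smul, star_trivial, star_one]; abel⟩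
    rw [map_add, Complex.add_re, hsmul] at h
    linarith
  have h1 : 0 < -(f 1).re := by
    have := hone 1 one_pos 0 (by simp)
    simpa using this
  have hre : ∀ x : A, 0 ≤ x → 0 ≤ -(f x).re := by
    intro x hx
    refine le_of_forall_pos_le_add fun δ hδ => ?_
    have := hone (δ / (-(f 1).re)) (by positivity) x
      (by rw [(IsSelfAdjoint.of_nonneg hx).star_eq]; exact add_nonneg hx hx)
    rw [div_mul_cancel₀ _ h1.ne'] at this
    exact this.le
  have him : ∀ x : A, IsSelfAdjoint x → (f x).im = 0 := by
    intro x hx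
    by_contra hne
    -- For self-adjoint `x` the element `itx` has zero real part for every real `t`, so `hone`
    -- applies with both signs of `t`.
    have key : ∀ t : ℝ, 0 < t * (f x).im + -(f 1).re := by
      intro t
      have := hone 1 one_pos ((Complex.I * (t : ℂ)) • x) (by simp [star_smul, hx.star_eq])
      rw [map_smul] at this
      simpa using this
    have := key (((f 1).re) / (f x).im)
    rw [div_mul_cancel₀ _ hne] at this
    linarith
  have hf1 : f 1 = ((f 1).re : ℂ) := Complex.ext (by simp) (by simp [him 1 (.one A)])
  have hf1ne : f 1 ≠ 0 := fun h => by simp [h] at h1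
  have hval : ∀ x, ((f 1)⁻¹ * f x).re = (f 1).re⁻¹ * (f x).re := by
    intro x; rw [hf1, ← Complex.ofReal_inv, Complex.re_ofReal_mul]; simp
  refine ⟨⟨PositiveLinearMap.mk₀ ((f 1)⁻¹ • f.toLinearMap) ?_, ?_⟩, ?_⟩
  · intro x hx
    have hx1 : f x = ((f x).re : ℂ) :=
      Complex.ext (by simp) (by simp [him x (.of_nonneg hx)])
    change 0 ≤ (f 1)⁻¹ * f x
    rw [hf1, hx1, ← Complex.ofReal_inv, ← Complex.ofReal_mul]
    refine Complex.zero_le_real.mpr ?_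
    exact mul_nonneg_of_nonpos_of_nonpos (inv_nonpos.mpr (by linarith)) (by linarith [hre x hx])
  · exact inv_mul_cancel₀ hf1ne
  · intro d hd
    change ((f 1)⁻¹ * f d).re = 0
    rw [hval, hf0 d hd, mul_zero]

theorem nonempty_state [Nontrivial A] : Nonempty (CStarState A) := by
  obtain ⟨φ, -⟩ := exists_state_re_eq_zero (⊥ : Submodule ℝ A) (by
    rintro d hd ⟨ε, hε, h⟩
    rw [Submodule.mem_bot] at hd
    subst hd
    simp only [star_zero, add_zero] at h
    have h2 : algebraMap ℝ A ε = 0 :=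
      le_antisymm h (by
        rw [Algebra.algebraMap_eq_smul_one]; exact smul_nonneg hε.le zero_le_one)
    rw [map_eq_zero] at h2
    exact hε.ne' h2)
  exact ⟨φ⟩

-- Polarisation: comparing the hypothesis at `x + y` and `x + iy` isolates the sesquilinear
-- identity.
omit [StarOrderedRing A] in
theorem CStarState.isTracial_of_star_mul_self (φ : CStarState A)
    (h : ∀ a : A, φ.1 (star a * a) = φ.1 (a * star a)) : φ.IsTracial := by
  have key : ∀ x y : A, φ.1 (star x * y) = φ.1 (y * star x) := by
    intro x y
    have h1 := h (x + y)
    have h2 := h (x + Complex.I • y)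
    simp only [star_add, star_smul, add_mul, mul_add, smul_mul_assoc, mul_smul_comm, map_add,
      map_smul, h x, h y, smul_eq_mul, Complex.star_def, Complex.conj_I] at h1 h2
    have h3 : Complex.I * Complex.I = -1 := Complex.I_mul_I
    linear_combination (1 / 2) * h1 - (1 / 2) * Complex.I * h2
      + (1 / 2) * (φ.1 (star x * y) - φ.1 (star y * x) - φ.1 (y * star x) + φ.1 (x * star y)) * h3
  intro a b
  simpa using key (star a) b

/-- Pairs `(∑ aᵢ* aᵢ, ∑ aᵢ aᵢ*)` of a C⋆-algebra without tracial states are separated. -/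
theorem exists_sum_star_mul_self_ge (hA : ¬ ∃ τ : CStarState A, τ.IsTracial) :
    ∃ (l : List A) (ε : ℝ), 0 < ε ∧
      (l.map fun a => a * star a).sum + algebraMap ℝ A ε ≤ (l.map fun a => star a * a).sum := by
  let D : Submodule ℝ A := Submodule.span ℝ (Set.range fun a : A => star a * a - a * star a)
  have hscale : ∀ (s : ℝ) (g : A → A) (l : List A),
      (l.map fun a => s • g a).sum = s • (l.map g).sum := by
    intro s g l
    induction l with
    | nil => simp
    | cons b l ih => simp [ih]
  have hmem : ∀ d ∈ D, ∃ l : List A,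
      d = (l.map fun a => star a * a).sum - (l.map fun a => a * star a).sum := by
    intro d hd
    induction hd using Submodule.span_induction with
    | mem x hx => obtain ⟨a, rfl⟩ := hx; exact ⟨[a], by simp⟩
    | zero => exact ⟨[], by simp⟩
    | add x y _ _ hx hy =>
      obtain ⟨l, rfl⟩ := hx
      obtain ⟨m, rfl⟩ := hy
      exact ⟨l ++ m, by simp only [List.map_append, List.sum_append]; abel⟩
    | smul t x _ hx =>
      obtain ⟨l, rfl⟩ := hx
      rcases le_total 0 t with ht | ht
      · refine ⟨l.map fun a => √t • a, ?_⟩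
        simp only [List.map_map, Function.comp_def, star_smul, star_trivial, smul_mul_smul_comm,
          Real.mul_self_sqrt ht, hscale, smul_sub]
      -- Passing to adjoints exchanges the two sums, which absorbs the negative sign.
      · refine ⟨l.map fun a => √(-t) • star a, ?_⟩
        simp only [List.map_map, Function.comp_def, star_smul, star_trivial, smul_mul_smul_comm,
          Real.mul_self_sqrt (neg_nonneg.mpr ht), star_star, hscale, smul_sub]
        simp only [neg_smul]
        abel
  by_contra hcon
  push Not at hcon
  refine hA ?_
  obtain ⟨φ, hφ⟩ := exists_state_re_eq_zero D (by
    rintro d hd ⟨ε, hε, h⟩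
    obtain ⟨l, rfl⟩ := hmem d hd
    refine hcon l (ε / 2) (by positivity) ?_
    have hs : ∀ g : A → A, (∀ a, star (g a) = g a) → star (l.map g).sum = (l.map g).sum := by
      intro g hg
      rw [← starAddEquiv_apply, map_list_sum, List.map_map]
      congr 2
      exact funext hg
    rw [star_sub, hs _ (fun a => by simp), hs _ (fun a => by simp)] at h
    have h2 := smul_le_smul_of_nonneg_left h (show (0 : ℝ) ≤ 1 / 2 by norm_num)
    rw [Algebra.algebraMap_eq_smul_one, smul_smul, ← two_smul ℝ, smul_smul] at h2
    norm_num at h2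
    rw [← sub_nonneg] at h2 ⊢
    convert h2 using 1
    rw [Algebra.algebraMap_eq_smul_one, div_eq_inv_mul]
    norm_num
    abel)
  refine ⟨φ, φ.isTracial_of_star_mul_self fun a => ?_⟩
  have h1 := hφ _ (Submodule.subset_span ⟨a, rfl⟩)
  simp only [map_sub, Complex.sub_re] at h1
  have p1 : 0 ≤ φ.1 (star a * a) := φ.1.map_nonneg (star_mul_self_nonneg a)
  have p2 : 0 ≤ φ.1 (a * star a) := φ.1.map_nonneg (mul_star_self_nonneg a)
  refine Complex.ext (by linarith) ?_
  rw [← (Complex.nonneg_iff.mp p1).2, ← (Complex.nonneg_iff.mp p2).2]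

/-- A unital C⋆-algebra without tracial states contains finitely many `aᵢ` with
`∑ aᵢ aᵢ* = 1` and `∑ aᵢ* aᵢ` strictly larger than `1`. -/
theorem exists_sum_mul_star_eq_one (hA : ¬ ∃ τ : CStarState A, τ.IsTracial) :
    ∃ (n : ℕ) (a : Fin n → A) (r : ℝ), 1 < r ∧
      ∑ i, a i * star (a i) = 1 ∧ algebraMap ℝ A r ≤ ∑ i, star (a i) * a i := by
  obtain ⟨l, ε, hε, hl⟩ := exists_sum_star_mul_self_ge hA
  set y := (l.map fun a => a * star a).sum with hy
  have hy0 : 0 ≤ y := List.sum_nonneg (by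
    intro x hx
    obtain ⟨a, -, rfl⟩ := List.mem_map.mp hx
    exact mul_star_self_nonneg a)
  set M : ℝ := ‖y‖ + 1 with hM
  have hM0 : 0 < M := by positivity
  have hyM : 0 ≤ algebraMap ℝ A M - y := sub_nonneg.mpr <|
    ((IsSelfAdjoint.of_nonneg hy0).le_algebraMap_norm_self).trans
      (algebraMap_mono A (by linarith))
  -- Being self-adjoint, `c` adds `M - y` to both sums: they become `M` and at least `M + ε`.
  -- Division by `M` gives `r = 1 + ε / M`.
  set c := CFC.sqrt (algebraMap ℝ A M - y) with hc
  have hcc : c * c = algebraMap ℝ A M - y := CFC.sqrt_mul_sqrt_self _ hyM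
  have hcs : star c = c := (IsSelfAdjoint.of_nonneg (CFC.sqrt_nonneg _)).star_eq
  have hsM : (√M)⁻¹ * (√M)⁻¹ = M⁻¹ := by
    rw [← mul_inv, Real.mul_self_sqrt hM0.le]
  have hget : ∀ g : A → A, ∑ i, g ((c :: l).get i) = ((c :: l).map g).sum := fun g => by
    rw [← List.sum_ofFn, ← Function.comp_def, ← List.map_ofFn, List.ofFn_get]
  refine ⟨(c :: l).length, fun i => (√M)⁻¹ • (c :: l).get i, 1 + M⁻¹ * ε,
    by have : 0 < M⁻¹ * ε := by positivity
       linarith, ?_, ?_⟩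
  · simp only [star_smul, star_trivial, smul_mul_smul_comm, hsM, ← Finset.smul_sum]
    rw [hget fun a => a * star a, List.map_cons, List.sum_cons, ← hy, hcs, hcc, sub_add_cancel,
      Algebra.algebraMap_eq_smul_one, smul_smul, inv_mul_cancel₀ hM0.ne', one_smul]
  · simp only [star_smul, star_trivial, smul_mul_smul_comm, hsM, ← Finset.smul_sum]
    rw [hget fun a => star a * a, List.map_cons, List.sum_cons, hcs, hcc]
    have h2 : algebraMap ℝ A (M + ε) ≤
        algebraMap ℝ A M - y + (l.map fun a => star a * a).sum := by
      have := add_le_add_right hl (algebraMap ℝ A M - y)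
      convert this using 1
      rw [map_add]; abel
    have h3 := smul_le_smul_of_nonneg_left h2 (inv_nonneg.mpr hM0.le)
    convert h3 using 1
    rw [Algebra.algebraMap_eq_smul_one, Algebra.algebraMap_eq_smul_one, smul_smul, mul_add,
      inv_mul_cancel₀ hM0.ne']

end States

/-! ### Algebra and order of the operators `S ⊗ T` -/

section TensorOp

variable {H K : Type*} [NormedAddCommGroup H] [InnerProductSpace ℂ H]
  [NormedAddCommGroup K] [InnerProductSpace ℂ K]

theorem HilbertTensor.continuousLinearMap_ext {E : Type*} [NormedAddCommGroup E] [NormedSpace ℂ E]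
    {S T : HilbertTensor H K →L[ℂ] E}
    (h : ∀ x y, S (HilbertTensor.of (x ⊗ₜ[ℂ] y)) = T (HilbertTensor.of (x ⊗ₜ[ℂ] y))) : S = T := by
  refine ContinuousLinearMap.ext fun z => congrFun (HilbertTensor.denseRange_of.equalizer
    S.continuous T.continuous (funext fun z => ?_)) z
  induction z with
  | zero => simp
  | tmul x y => exact h x y
  | add x y hx hy => simpa using congrArg₂ (· + ·) hx hy

theorem tensorOp_mul (S S' : H →L[ℂ] H) (T T' : K →L[ℂ] K) :
    tensorOp S T * tensorOp S' T' = tensorOp (S * S') (T * T') :=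
  HilbertTensor.continuousLinearMap_ext fun x y => by
    simp [tensorOp_of]

theorem tensorOp_one : tensorOp (1 : H →L[ℂ] H) (1 : K →L[ℂ] K) = 1 :=
  HilbertTensor.continuousLinearMap_ext fun x y => by simp [tensorOp_of]

theorem tensorOp_add_left (S S' : H →L[ℂ] H) (T : K →L[ℂ] K) :
    tensorOp (S + S') T = tensorOp S T + tensorOp S' T :=
  HilbertTensor.continuousLinearMap_ext fun x y => by
    simp [tensorOp_of, TensorProduct.add_tmul]

theorem tensorOp_add_right (S : H →L[ℂ] H) (T T' : K →L[ℂ] K) :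
    tensorOp S (T + T') = tensorOp S T + tensorOp S T' :=
  HilbertTensor.continuousLinearMap_ext fun x y => by
    simp [tensorOp_of, TensorProduct.tmul_add]

theorem tensorOp_smul_left (c : ℂ) (S : H →L[ℂ] H) (T : K →L[ℂ] K) :
    tensorOp (c • S) T = c • tensorOp S T :=
  HilbertTensor.continuousLinearMap_ext fun x y => by
    simp [tensorOp_of, ← TensorProduct.smul_tmul']

theorem tensorOp_smul_right (c : ℂ) (S : H →L[ℂ] H) (T : K →L[ℂ] K) :
    tensorOp S (c • T) = c • tensorOp S T :=
  HilbertTensor.continuousLinearMap_ext fun x y => by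
    simp [tensorOp_of]

/-- The operator `S ⊗ T` as a bilinear map in `S` and `T`. -/
def tensorOpBilin : (H →L[ℂ] H) →ₗ[ℂ] (K →L[ℂ] K) →ₗ[ℂ]
    (HilbertTensor H K →L[ℂ] HilbertTensor H K) :=
  LinearMap.mk₂ ℂ tensorOp tensorOp_add_left tensorOp_smul_left tensorOp_add_right
    tensorOp_smul_right

variable [CompleteSpace H] [CompleteSpace K]

omit [CompleteSpace H] [CompleteSpace K] in
theorem HilbertTensor.inner_ext {S T : HilbertTensor H K →L[ℂ] HilbertTensor H K}
    (h : ∀ x y x' y', ⟪S (HilbertTensor.of (x ⊗ₜ[ℂ] y)), HilbertTensor.of (x' ⊗ₜ[ℂ] y')⟫_ℂ =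
      ⟪T (HilbertTensor.of (x ⊗ₜ[ℂ] y)), HilbertTensor.of (x' ⊗ₜ[ℂ] y')⟫_ℂ) : S = T := by
  refine HilbertTensor.continuousLinearMap_ext fun x y => ?_
  refine ext_inner_right ℂ fun w => ?_
  exact congrArg (fun f : HilbertTensor H K →L[ℂ] ℂ => f w)
    (HilbertTensor.continuousLinearMap_ext (S := innerSL ℂ _) (T := innerSL ℂ _) (h x y))

theorem star_tensorOp (S : H →L[ℂ] H) (T : K →L[ℂ] K) :
    star (tensorOp S T) = tensorOp (star S) (star T) := by
  refine HilbertTensor.inner_ext fun x y x' y' => ?_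
  rw [ContinuousLinearMap.star_eq_adjoint, ContinuousLinearMap.adjoint_inner_left,
    tensorOp_of, tensorOp_of, HilbertTensor.inner_of, HilbertTensor.inner_of,
    ContinuousLinearMap.star_eq_adjoint, ContinuousLinearMap.star_eq_adjoint,
    ContinuousLinearMap.adjoint_inner_left, ContinuousLinearMap.adjoint_inner_left]

/-- Factor both operators: `s*s ⊗ t*t = (s ⊗ t)*(s ⊗ t)`. -/
theorem tensorOp_nonneg {S : H →L[ℂ] H} {T : K →L[ℂ] K} (hS : 0 ≤ S) (hT : 0 ≤ T) :
    0 ≤ tensorOp S T := by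
  obtain ⟨s, rfl⟩ := CStarAlgebra.nonneg_iff_eq_star_mul_self.mp hS
  obtain ⟨t, rfl⟩ := CStarAlgebra.nonneg_iff_eq_star_mul_self.mp hT
  rw [← tensorOp_mul, ← star_tensorOp]
  exact star_mul_self_nonneg _

theorem tensorOp_mono_right {S : H →L[ℂ] H} (hS : 0 ≤ S) {T T' : K →L[ℂ] K} (h : T ≤ T') :
    tensorOp S T ≤ tensorOp S T' := by
  rw [← sub_nonneg]
  refine (tensorOp_nonneg hS (sub_nonneg.mpr h)).trans_eq ?_
  exact (tensorOpBilin S).map_sub T' T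

theorem tensorOp_mono_left {S S' : H →L[ℂ] H} (h : S ≤ S') {T : K →L[ℂ] K} (hT : 0 ≤ T) :
    tensorOp S T ≤ tensorOp S' T := by
  rw [← sub_nonneg]
  refine (tensorOp_nonneg (sub_nonneg.mpr h) hT).trans_eq ?_
  exact tensorOpBilin.map_sub₂ S' S T

variable {A B : Type*} [CStarAlgebra A] [CStarAlgebra B]

/-- The algebra homomorphism underlying `tensorRep`. -/
def tensorAlgHom (π : A →⋆ₐ[ℂ] (H →L[ℂ] H)) (ρ : B →⋆ₐ[ℂ] (K →L[ℂ] K)) :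
    A ⊗[ℂ] B →ₐ[ℂ] (HilbertTensor H K →L[ℂ] HilbertTensor H K) :=
  Algebra.TensorProduct.algHomOfLinearMapTensorProduct
    (TensorProduct.lift (tensorOpBilin.compl₁₂ π.toAlgHom.toLinearMap ρ.toAlgHom.toLinearMap))
    (fun a a' b b' => by
      change tensorOp (π (a * a')) (ρ (b * b')) = tensorOp (π a) (ρ b) * tensorOp (π a') (ρ b')
      rw [tensorOp_mul, map_mul, map_mul])
    (by
      change tensorOp (π 1) (ρ 1) = 1
      rw [map_one, map_one, tensorOp_one])

/-- The representation `π ⊗ ρ` of the algebraic tensor product. -/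
def tensorRep (π : A →⋆ₐ[ℂ] (H →L[ℂ] H)) (ρ : B →⋆ₐ[ℂ] (K →L[ℂ] K)) :
    A ⊗[ℂ] B →⋆ₐ[ℂ] (HilbertTensor H K →L[ℂ] HilbertTensor H K) where
  toAlgHom := tensorAlgHom π ρ
  map_star' x := by
    change tensorAlgHom π ρ (star x) = star (tensorAlgHom π ρ x)
    induction x with
    | zero => simp
    | tmul a b =>
      change tensorOp (π (star a)) (ρ (star b)) = star (tensorOp (π a) (ρ b))
      rw [star_tensorOp, map_star, map_star]
    | add x y hx hy => rw [star_add, map_add, map_add, star_add, hx, hy]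

theorem tensorRep_tmul (π : A →⋆ₐ[ℂ] (H →L[ℂ] H)) (ρ : B →⋆ₐ[ℂ] (K →L[ℂ] K)) (a : A) (b : B) :
    tensorRep π ρ (a ⊗ₜ[ℂ] b) = tensorOp (π a) (ρ b) := rfl

theorem tensorRep_mem_spatialTensor (π : A →⋆ₐ[ℂ] (H →L[ℂ] H)) (ρ : B →⋆ₐ[ℂ] (K →L[ℂ] K))
    (x : A ⊗[ℂ] B) : tensorRep π ρ x ∈ spatialTensor π ρ := by
  induction x with
  | zero => rw [map_zero]; exact zero_mem _
  | tmul a b =>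
    exact StarSubalgebra.le_topologicalClosure _ (StarAlgebra.subset_adjoin ℂ _ ⟨a, b, rfl⟩)
  | add x y hx hy => rw [map_add]; exact add_mem hx hy

end TensorOp

/-! ### Support projections and translations on `ℓ²(G)` -/

section FreeGroup

variable {G : Type*}

open Classical in
/-- The projection of `ℓ²(G)` onto the functions supported in `W`. -/
def indicatorOp (W : Set G) : EllTwo G →L[ℂ] EllTwo G :=
  lp.mapCLM 2 (fun g => if g ∈ W then ContinuousLinearMap.id ℂ ℂ else 0) zero_le_one (fun g => by
    split_ifs
    · exact ContinuousLinearMap.norm_id_le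
    · simp)

open Classical in
theorem indicatorOp_apply (W : Set G) (ξ : EllTwo G) (g : G) :
    indicatorOp W ξ g = if g ∈ W then ξ g else 0 := by
  change (if g ∈ W then ContinuousLinearMap.id ℂ ℂ else 0) (ξ g) = _
  split_ifs <;> rfl

theorem star_indicatorOp (W : Set G) : star (indicatorOp W) = indicatorOp W := by
  symm
  refine (ContinuousLinearMap.eq_adjoint_iff _ _).mpr fun ξ η => ?_
  classical
  simp only [lp.inner_eq_tsum, indicatorOp_apply]
  refine tsum_congr fun g => ?_
  split_ifs <;> simp

theorem indicatorOp_mul (V W : Set G) : indicatorOp V * indicatorOp W = indicatorOp (V ∩ W) := by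
  classical
  ext ξ g
  by_cases hV : g ∈ V <;> by_cases hW : g ∈ W <;>
    simp [indicatorOp_apply, hV, hW]

theorem indicatorOp_empty : indicatorOp (∅ : Set G) = 0 := by
  ext ξ g
  simp [indicatorOp_apply]

theorem indicatorOp_nonneg (W : Set G) : 0 ≤ indicatorOp W := by
  have h := star_mul_self_nonneg (indicatorOp W)
  rwa [star_indicatorOp, indicatorOp_mul, Set.inter_self] at h

theorem indicatorOp_compl (W : Set G) : indicatorOp Wᶜ = 1 - indicatorOp W := by
  classical
  ext ξ g
  by_cases hW : g ∈ W <;> simp [indicatorOp_apply, hW]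

theorem indicatorOp_le_one (W : Set G) : indicatorOp W ≤ 1 := by
  rw [← sub_nonneg, ← indicatorOp_compl]
  exact indicatorOp_nonneg _

theorem sum_indicatorOp {ι : Type*} (s : Finset ι) (W : ι → Set G)
    (h : Pairwise fun i j => Disjoint (W i) (W j)) :
    ∑ i ∈ s, indicatorOp (W i) = indicatorOp (⋃ i ∈ s, W i) := by
  classical
  induction s using Finset.induction_on with
  | empty => simp [indicatorOp_empty]
  | insert a s ha ih =>
    rw [Finset.sum_insert ha, ih, Finset.set_biUnion_insert]
    have hd : Disjoint (W a) (⋃ i ∈ s, W i) := by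
      rw [Set.disjoint_iUnion₂_right]
      exact fun i hi => h fun e => ha (e ▸ hi)
    ext ξ g
    by_cases h1 : g ∈ W a
    · have h2 : g ∉ ⋃ i ∈ s, W i := Set.disjoint_left.mp hd h1
      simp only [add_apply, lp.coeFn_add, Pi.add_apply, indicatorOp_apply,
        Set.mem_union, h1, h2, if_true, if_false, add_zero, true_or]
    · simp only [add_apply, lp.coeFn_add, Pi.add_apply, indicatorOp_apply,
        Set.mem_union, h1, if_false, zero_add, false_or]

variable [Group G]

theorem leftRegular_mul (g h : G) : leftRegular g * leftRegular h = leftRegular (g * h) := by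
  ext ξ k
  simp [leftRegular_apply, mul_assoc]

theorem leftRegular_one : leftRegular (1 : G) = 1 := by
  ext ξ k
  simp [leftRegular_apply]

theorem star_leftRegular (g : G) : star (leftRegular g) = leftRegular g⁻¹ := by
  symm
  refine (ContinuousLinearMap.eq_adjoint_iff _ _).mpr fun ξ η => ?_
  simp only [lp.inner_eq_tsum, leftRegular_apply, inv_inv]
  rw [← (Equiv.mulLeft g).tsum_eq fun h => inner ℂ (ξ h) (η (g⁻¹ * h))]
  simp

theorem leftRegular_mul_indicatorOp (g : G) (V W : Set G) (h : ∀ x, g * x ∈ W ↔ x ∈ V) :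
    leftRegular g * indicatorOp V = indicatorOp W * leftRegular g := by
  classical
  ext ξ k
  have : k ∈ W ↔ g⁻¹ * k ∈ V := by rw [← h, mul_inv_cancel_left]
  simp only [mul_apply_eq_comp, leftRegular_apply, indicatorOp_apply, this]

end FreeGroup

/-! ### Left invertibility as a lower bound on `T*T` -/

section LeftInvertible

variable {C : Type*} [CStarAlgebra C] [PartialOrder C] [StarOrderedRing C]

/-- Take `L = (T*T)⁻¹T*`; then `LL* = (T*T)⁻¹ ≤ r⁻¹`, which gives the norm bound used in the
perturbation argument. -/
theorem exists_mul_eq_one_of_algebraMap_le {T : C} {r : ℝ} (hr : 0 < r)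
    (h : algebraMap ℝ C r ≤ star T * T) : ∃ L : C, L * T = 1 ∧ ‖L‖ * ‖L‖ ≤ r⁻¹ := by
  have hru : IsUnit (algebraMap ℝ C r) := (IsUnit.mk0 r hr.ne').map (algebraMap ℝ C)
  have hr0 : 0 ≤ algebraMap ℝ C r := algebraMap_nonneg C hr.le
  obtain ⟨w, hw⟩ : IsUnit (star T * T) :=
    CStarAlgebra.isUnit_of_le (algebraMap ℝ C r) h (hru.isStrictlyPositive hr0)
  have hw0 : 0 ≤ (w : C) := hw ▸ star_mul_self_nonneg T
  have hLT : ((w⁻¹ : Cˣ) : C) * star T * T = 1 := by rw [mul_assoc, ← hw, Units.inv_mul]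
  refine ⟨((w⁻¹ : Cˣ) : C) * star T, hLT, ?_⟩
  have hwi : star ((w⁻¹ : Cˣ) : C) = ((w⁻¹ : Cˣ) : C) := by
    have : star w = w := Units.ext (by simpa using (IsSelfAdjoint.of_nonneg hw0).star_eq)
    rw [← Units.coe_star, star_inv, this]
  rw [← CStarRing.norm_self_mul_star, star_mul, star_star, hwi, ← mul_assoc, hLT, one_mul]
  have h1 : ((w⁻¹ : Cˣ) : C) ≤ ((hru.unit⁻¹ : Cˣ) : C) :=
    CStarAlgebra.inv_le_inv (a := hru.unit) (b := w) hr0 (by rw [hw]; exact h)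
  have h2 : ((hru.unit⁻¹ : Cˣ) : C) = algebraMap ℝ C r⁻¹ := by
    refine Units.inv_eq_of_mul_eq_one_right ?_
    rw [IsUnit.unit_spec, ← map_mul, mul_inv_cancel₀ hr.ne', map_one]
  have h3 : 0 ≤ ((w⁻¹ : Cˣ) : C) := by
    have h := star_left_conjugate_nonneg hw0 ((w⁻¹ : Cˣ) : C)
    rwa [mul_assoc, Units.mul_inv, mul_one, hwi] at h
  rw [CStarAlgebra.norm_le_iff_le_algebraMap _ (inv_nonneg.mpr hr.le) h3, ← h2]
  exact h1

/-- From `LT = 1` follows `1 = T*(L*L)T ≤ ‖L*L‖ T*T`. The added `1` in `m` keeps it positive even in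
the zero algebra. -/
theorem exists_algebraMap_le_of_mul_eq_one {T L : C} (h : L * T = 1) :
    ∃ δ : ℝ, 0 < δ ∧ algebraMap ℝ C δ ≤ star T * T := by
  set m : ℝ := ‖star L * L‖ + 1 with hm
  have hm0 : 0 < m := by positivity
  have h1 : star T * (star L * L) * T ≤ ‖star L * L‖ • (star T * T) :=
    CStarAlgebra.star_left_conjugate_le_norm_smul
  have h2 : star T * (star L * L) * T = 1 := by
    rw [← mul_assoc, ← star_mul, mul_assoc, h, star_one, one_mul]
  have h3 : (1 : C) ≤ m • (star T * T) := by
    rw [hm, add_smul, one_smul, ← h2]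
    exact h1.trans (le_add_of_nonneg_right (star_mul_self_nonneg T))
  refine ⟨m⁻¹, by positivity, ?_⟩
  have h4 := smul_le_smul_of_nonneg_left h3 (inv_nonneg.mpr hm0.le)
  rwa [smul_smul, inv_mul_cancel₀ hm0.ne', one_smul, ← Algebra.algebraMap_eq_smul_one] at h4

/-- A small perturbation of an element that is bounded below is left invertible, and is
invertible only if the original element is. -/
theorem leftInvertible_add {S R : C} {r s : ℝ} (hs : 0 ≤ s) (hsr : s < r)
    (hS : algebraMap ℝ C r ≤ star S * S) (hR : R * star R ≤ algebraMap ℝ C s) :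
    (∃ L, L * (S + R) = 1) ∧ (IsUnit (S + R) → IsUnit S) := by
  have hr : 0 < r := hs.trans_lt hsr
  obtain ⟨L, hL, hLn⟩ := exists_mul_eq_one_of_algebraMap_le hr hS
  have hRn : ‖R‖ * ‖R‖ ≤ s := by
    rw [← CStarRing.norm_self_mul_star]
    exact (CStarAlgebra.norm_le_iff_le_algebraMap (R * star R) hs (mul_star_self_nonneg R)).mpr hR
  have hLR : ‖-(L * R)‖ < 1 := by
    rw [norm_neg]
    refine (norm_mul_le L R).trans_lt (lt_of_mul_self_lt_mul_self₀ zero_le_one ?_)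
    calc ‖L‖ * ‖R‖ * (‖L‖ * ‖R‖) = (‖L‖ * ‖L‖) * (‖R‖ * ‖R‖) := by ring
      _ ≤ r⁻¹ * s := by gcongr
      _ < 1 * 1 := by rw [inv_mul_lt_iff₀ hr]; linarith
  have hu : IsUnit (L * (S + R)) := by
    have := isUnit_one_sub_of_norm_lt_one hLR
    rwa [sub_neg_eq_add, ← hL, ← mul_add] at this
  obtain ⟨w, hw⟩ := hu
  refine ⟨⟨((w⁻¹ : Cˣ) : C) * L, by rw [mul_assoc, ← hw, Units.inv_mul]⟩, fun hT => ?_⟩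
  obtain ⟨t, ht⟩ := hT
  -- Both `L(S + R)` and `S + R` are invertible, hence so is `L`, and `LS = 1` makes `S` its
  -- inverse.
  have hLu : IsUnit L := by
    refine ⟨w * t⁻¹, ?_⟩
    rw [Units.val_mul, hw, ← ht, mul_assoc, Units.mul_inv, mul_one]
  obtain ⟨l, rfl⟩ := hLu
  exact ⟨l⁻¹, by rw [Units.inv_eq_of_mul_eq_one_right hL]⟩

end LeftInvertible

/-! ### The sum over free generators -/

section Gram

variable {H K : Type*} [NormedAddCommGroup H] [InnerProductSpace ℂ H] [CompleteSpace H]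
  [NormedAddCommGroup K] [InnerProductSpace ℂ K] [CompleteSpace K]

omit [CompleteSpace H] [CompleteSpace K] in
theorem tensorOp_sum_right {J : Type*} (s : Finset J) (S : H →L[ℂ] H) (v : J → K →L[ℂ] K) :
    tensorOp S (∑ j ∈ s, v j) = ∑ j ∈ s, tensorOp S (v j) :=
  map_sum (tensorOpBilin S) v s

omit [CompleteSpace H] [CompleteSpace K] in
theorem tensorOp_sum_left {J : Type*} (s : Finset J) (b : J → H →L[ℂ] H) (T : K →L[ℂ] K) :
    tensorOp (∑ j ∈ s, b j) T = ∑ j ∈ s, tensorOp (b j) T :=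
  LinearMap.map_sum₂ tensorOpBilin s b T

omit [CompleteSpace H] [CompleteSpace K] in
theorem tensorOp_algebraMap (r s : ℝ) :
    tensorOp (algebraMap ℝ (H →L[ℂ] H) r) (algebraMap ℝ (K →L[ℂ] K) s) =
      algebraMap ℝ _ (r * s) := by
  simp only [Algebra.algebraMap_eq_smul_one, ← Complex.coe_smul, tensorOp_smul_left,
    tensorOp_smul_right, tensorOp_one, smul_smul, Complex.ofReal_mul,
    mul_comm]

theorem star_sum_tensorOp {J : Type*} (s : Finset J) (b : J → H →L[ℂ] H) (v : J → K →L[ℂ] K) :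
    star (∑ j ∈ s, tensorOp (b j) (v j)) = ∑ j ∈ s, tensorOp (star (b j)) (star (v j)) := by
  rw [star_sum]
  exact Finset.sum_congr rfl fun j _ => star_tensorOp _ _

theorem star_sum_tensorOp_mul_self {J : Type*} [Fintype J] (b : J → H →L[ℂ] H)
    (v : J → K →L[ℂ] K) (hv : ∀ i j, i ≠ j → star (v i) * v j = 0) :
    star (∑ j, tensorOp (b j) (v j)) * ∑ j, tensorOp (b j) (v j) =
      ∑ j, tensorOp (star (b j) * b j) (star (v j) * v j) := by
  rw [star_sum_tensorOp, Finset.sum_mul_sum]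
  refine Finset.sum_congr rfl fun i _ => ?_
  rw [Finset.sum_eq_single i, tensorOp_mul]
  · intro j _ hj
    rw [tensorOp_mul, hv i j hj.symm]
    exact (tensorOpBilin _).map_zero
  · simp

/-- The two operators have ranges supported in the disjoint sets `W` and `W'`. -/
theorem star_indicatorOp_complement_mul {G : Type*} [Group G] (g h : G) {V V' W W' : Set G}
    (hV : ∀ x, x ∉ V → g * x ∈ W) (hV' : ∀ x, x ∉ V' → h * x ∈ W') (hd : Disjoint W W') :
    star (leftRegular g * indicatorOp Vᶜ) * (leftRegular h * indicatorOp V'ᶜ) = 0 := by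
  have key : ∀ (k : G) (U : Set G), leftRegular k * indicatorOp U =
      indicatorOp {x | k⁻¹ * x ∈ U} * leftRegular k := fun k U =>
    leftRegular_mul_indicatorOp k U _ fun x => by simp
  have hempty : {x | g⁻¹ * x ∈ Vᶜ} ∩ {x | h⁻¹ * x ∈ V'ᶜ} = ∅ := by
    rw [← Set.disjoint_iff_inter_eq_empty, Set.disjoint_left]
    intro x hx hx'
    have h1 : x ∈ W := by simpa using hV _ hx
    have h2 : x ∈ W' := by simpa using hV' _ hx'
    exact Set.disjoint_left.mp hd h1 h2
  rw [key g, key h, star_mul, star_indicatorOp, mul_assoc, ← mul_assoc (indicatorOp _),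
    indicatorOp_mul, hempty, indicatorOp_empty, zero_mul, mul_zero]

theorem star_leftRegular_mul_indicatorOp_self {G : Type*} [Group G] (g : G) (V : Set G) :
    star (leftRegular g * indicatorOp V) * (leftRegular g * indicatorOp V) = indicatorOp V := by
  rw [star_mul, star_indicatorOp, mul_assoc, ← mul_assoc _ (leftRegular g), star_leftRegular,
    leftRegular_mul, inv_mul_cancel, leftRegular_one, one_mul, indicatorOp_mul, Set.inter_self]

theorem leftRegular_mul_indicatorOp_mul_star_le {G : Type*} [Group G] (g : G) (V : Set G) :
    leftRegular g * indicatorOp V * star (leftRegular g * indicatorOp V) ≤ 1 := by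
  rw [star_mul, star_indicatorOp, mul_assoc, ← mul_assoc (indicatorOp _), indicatorOp_mul,
    Set.inter_self, ← mul_assoc]
  refine (star_right_conjugate_le_conjugate (indicatorOp_le_one V) (leftRegular g)).trans_eq ?_
  rw [mul_one, star_leftRegular, leftRegular_mul, mul_inv_cancel, leftRegular_one]

variable {G : Type*} {n N : ℕ} {a : Fin n → H →L[ℂ] H} {V : Fin n × Fin N → Set G}

/-- By disjointness the projections onto the `V k` sum to a single projection, so passing to
complements costs at most `1` out of `N`. -/
theorem algebraMap_le_sum_indicatorOp_compl {N : ℕ} {V : Fin N → Set G}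
    (hV : Pairwise fun k l => Disjoint (V k) (V l)) :
    algebraMap ℝ (EllTwo G →L[ℂ] EllTwo G) ((N : ℝ) - 1) ≤ ∑ k, indicatorOp (V k)ᶜ := by
  have h1 : ∑ k, indicatorOp (V k)ᶜ =
      algebraMap ℝ (EllTwo G →L[ℂ] EllTwo G) N - ∑ k, indicatorOp (V k) := by
    simp only [indicatorOp_compl, Finset.sum_sub_distrib, Finset.sum_const, Finset.card_univ,
      Fintype.card_fin, nsmul_eq_mul, mul_one, map_natCast]
  rw [h1, sum_indicatorOp _ _ hV, map_sub, map_one]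
  exact sub_le_sub_left (indicatorOp_le_one _) _

theorem algebraMap_le_sum_tensorOp {v : Fin n × Fin N → K →L[ℂ] K} {r s : ℝ} (hs : 0 ≤ s)
    (ha : algebraMap ℝ (H →L[ℂ] H) r ≤ ∑ i, star (a i) * a i)
    (hv : ∀ i, algebraMap ℝ (K →L[ℂ] K) s ≤ ∑ k, v (i, k)) :
    algebraMap ℝ (HilbertTensor H K →L[ℂ] HilbertTensor H K) (r * s) ≤
      ∑ j : Fin n × Fin N, tensorOp (star (a j.1) * a j.1) (v j) := by
  have hsum : ∑ j : Fin n × Fin N, tensorOp (star (a j.1) * a j.1) (v j) =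
      ∑ i, tensorOp (star (a i) * a i) (∑ k, v (i, k)) := by
    rw [Fintype.sum_prod_type]
    simp only [tensorOp_sum_right]
  have h0 : 0 ≤ algebraMap ℝ (K →L[ℂ] K) s := algebraMap_nonneg _ hs
  have h1 := tensorOp_mono_left ha h0
  rw [tensorOp_algebraMap, tensorOp_sum_left] at h1
  rw [hsum]
  refine h1.trans (Finset.sum_le_sum fun i _ => ?_)
  exact tensorOp_mono_right (star_mul_self_nonneg (a i)) (hv i)

theorem sum_tensorOp_mul_star_le {v : Fin n × Fin N → K →L[ℂ] K}
    (ha : ∑ i, a i * star (a i) = 1) (hv : ∀ j, v j ≤ 1) :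
    ∑ j, tensorOp (a j.1 * star (a j.1)) (v j) ≤ algebraMap ℝ _ (N : ℝ) := by
  calc _ ≤ ∑ j : Fin n × Fin N, tensorOp (a j.1 * star (a j.1)) 1 :=
        Finset.sum_le_sum fun j _ => tensorOp_mono_right (mul_star_self_nonneg _) (hv j)
    _ = _ := by
        rw [Fintype.sum_prod_type]
        simp only [Finset.sum_const, Finset.card_univ, Fintype.card_fin]
        rw [← Finset.smul_sum, ← tensorOp_sum_left, ha, tensorOp_one]
        simp

omit [CompleteSpace H] in
theorem tensorOp_one_indicatorOp_singleton_ne_zero [Nontrivial H] (g : G) :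
    tensorOp (1 : H →L[ℂ] H) (indicatorOp {g}) ≠ 0 := by
  intro hP0
  obtain ⟨x, hx⟩ := exists_ne (0 : H)
  classical
  have h0 := congrArg (fun T => T (HilbertTensor.of
    (x ⊗ₜ[ℂ] (lp.single 2 g (1 : ℂ))))) hP0
  have hfix : indicatorOp {g} (lp.single 2 g (1 : ℂ)) = lp.single 2 g (1 : ℂ) := by
    ext k
    rw [indicatorOp_apply]
    by_cases hg : k = g <;> simp [hg]
  simp only [tensorOp_of, hfix, one_apply_eq_self, zero_apply] at h0
  rw [← norm_eq_zero, LinearIsometry.norm_map, TensorProduct.norm_tmul] at h0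
  simp [hx] at h0

/-- If `∑ aᵢ aᵢ* = 1` and `∑ aᵢ* aᵢ` is strictly larger than `1`, then a sum of sufficiently many
copies of the `aᵢ`, tensored with distinct free generators, is left invertible but not
invertible. -/
theorem exists_leftInvertible_sum_tensorOp [Nontrivial H] {n : ℕ} (a : Fin n → H →L[ℂ] H)
    {r : ℝ} (hr : 1 < r) (h1 : ∑ i, a i * star (a i) = 1)
    (h2 : algebraMap ℝ (H →L[ℂ] H) r ≤ ∑ i, star (a i) * a i) :
    ∃ (N : ℕ) (e : Fin n × Fin N → ℕ) (T : HilbertTensor H (EllTwo (FreeGroup ℕ)) →L[ℂ] _),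
      T = ∑ j, tensorOp (a j.1) (leftRegular (FreeGroup.of (e j))) ∧
      (∃ L, L * T = 1) ∧ ¬ IsUnit T := by
  -- This is exactly the condition `N < (N - 1) * r` needed for `S` to dominate `R`.
  obtain ⟨N, hN⟩ := exists_nat_gt (r / (r - 1))
  rw [div_lt_iff₀ (by linarith)] at hN
  let e : Fin n × Fin N → ℕ := Encodable.encode
  have he : Function.Injective e := Encodable.encode_injective
  -- The Boolean `false` marks an inverse letter: left multiplication by the generator cancels
  -- precisely on `V j`, and sends everything else into `W j`.
  let V : Fin n × Fin N → Set (FreeGroup ℕ) := fun j => FreeGroup.startsWith (e j, false)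
  let W : Fin n × Fin N → Set (FreeGroup ℕ) := fun j => FreeGroup.startsWith (e j, true)
  have hVd : ∀ i j, i ≠ j → Disjoint (V i) (V j) := fun i j hij =>
    FreeGroup.startsWith.disjoint_iff_ne.mpr fun h => hij (he (Prod.ext_iff.mp h).1)
  have hWd : ∀ i j, i ≠ j → Disjoint (W i) (W j) := fun i j hij =>
    FreeGroup.startsWith.disjoint_iff_ne.mpr fun h => hij (he (Prod.ext_iff.mp h).1)
  let u : Fin n × Fin N → EllTwo (FreeGroup ℕ) →L[ℂ] EllTwo (FreeGroup ℕ) :=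
    fun j => leftRegular (FreeGroup.of (e j))
  have hVW : ∀ j x, x ∉ V j → FreeGroup.of (e j) * x ∈ W j := fun j x hx =>
    FreeGroup.startsWith_mk_mul (w := (e j, true)) x hx
  let S := ∑ j, tensorOp (a j.1) (u j * indicatorOp (V j)ᶜ)
  let R := ∑ j, tensorOp (a j.1) (u j * indicatorOp (V j))
  have hSS : star S * S = ∑ j, tensorOp (star (a j.1) * a j.1) (indicatorOp (V j)ᶜ) := by
    rw [star_sum_tensorOp_mul_self _ _ fun i j hij =>
      star_indicatorOp_complement_mul _ _ (hVW i) (hVW j) (hWd i j hij)]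
    simp only [star_leftRegular_mul_indicatorOp_self]
  have hRR : R * star R = ∑ j, tensorOp (a j.1 * star (a j.1))
      (u j * indicatorOp (V j) * star (u j * indicatorOp (V j))) := by
    -- The Gram formula is applied to `star R`, whose cross terms vanish because the sets `V j` are
    -- disjoint.
    have hR : R = star (star R) := (star_star R).symm
    have hR' : star R = ∑ j, tensorOp (star (a j.1)) (star (u j * indicatorOp (V j))) :=
      star_sum_tensorOp _ _ _
    rw [hR, star_star (star R), hR', star_sum_tensorOp_mul_self]
    · simp only [star_star]
    · intro i j hij
      rw [star_star, star_mul, star_indicatorOp, mul_assoc, ← mul_assoc (indicatorOp _),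
        indicatorOp_mul, Set.disjoint_iff_inter_eq_empty.mp (hVd i j hij), indicatorOp_empty,
        zero_mul, mul_zero]
  have hN1 : (0 : ℝ) ≤ N - 1 := by
    have : (1 : ℝ) < N := by nlinarith
    linarith
  have hbound : algebraMap ℝ _ ((N - 1) * r) ≤ star S * S := by
    rw [hSS]
    rw [mul_comm]
    exact algebraMap_le_sum_tensorOp hN1 h2 fun i => algebraMap_le_sum_indicatorOp_compl
      fun k l hkl => hVd _ _ fun h => hkl (Prod.ext_iff.mp h).2
  have hRbound : R * star R ≤ algebraMap ℝ _ (N : ℝ) := by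
    rw [hRR]
    exact sum_tensorOp_mul_star_le h1 fun j => leftRegular_mul_indicatorOp_mul_star_le _ _
  have hT : ∑ j, tensorOp (a j.1) (u j) = S + R := by
    rw [← Finset.sum_add_distrib]
    refine Finset.sum_congr rfl fun j _ => ?_
    rw [← tensorOp_add_right, indicatorOp_compl, ← mul_add, sub_add_cancel, mul_one]
  obtain ⟨hL, hunit⟩ := leftInvertible_add (Nat.cast_nonneg N) (by linarith) hbound hRbound
  refine ⟨N, e, _, rfl, hT ▸ hL, fun hu => ?_⟩
  have hSu : IsUnit S := hunit (hT ▸ hu)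
  -- The empty word lies in no `W j`, so `S` never reaches `H ⊗ δ₁`; an invertible `S` would force
  -- this nonzero projection to vanish.
  have hP : tensorOp (1 : H →L[ℂ] H) (indicatorOp {(1 : FreeGroup ℕ)}) * S = 0 := by
    rw [Finset.mul_sum]
    refine Finset.sum_eq_zero fun j _ => ?_
    have hj : u j * indicatorOp (V j)ᶜ =
        indicatorOp {x | (FreeGroup.of (e j))⁻¹ * x ∈ (V j)ᶜ} * u j :=
      leftRegular_mul_indicatorOp _ _ _ fun x => by simp
    have hempty : {(1 : FreeGroup ℕ)} ∩ {x | (FreeGroup.of (e j))⁻¹ * x ∈ (V j)ᶜ} = ∅ := by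
      rw [Set.singleton_inter_eq_empty]
      intro hx
      exact FreeGroup.startsWith.ne_one _ (hVW j _ hx) (by simp)
    rw [tensorOp_mul, hj, ← mul_assoc, indicatorOp_mul, hempty, indicatorOp_empty, zero_mul]
    exact (tensorOpBilin _).map_zero
  exact tensorOp_one_indicatorOp_singleton_ne_zero _ ((hSu.mul_left_eq_zero).mp hP)

end Gram

/-! ### Positivity and matrix amplifications -/

/-- An injective star homomorphism preserves the spectrum of a self-adjoint element. -/
theorem StarAlgHom.nonneg_of_map_nonneg {C D : Type*} [CStarAlgebra C] [PartialOrder C]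
    [StarOrderedRing C] [CStarAlgebra D] [PartialOrder D] [StarOrderedRing D] (f : C →⋆ₐ[ℂ] D)
    (hf : Function.Injective f) {x : C} (hx : 0 ≤ f x) : 0 ≤ x := by
  have hsa : IsSelfAdjoint x := hf (by rw [map_star, (IsSelfAdjoint.of_nonneg hx).star_eq])
  rw [StarOrderedRing.nonneg_iff_spectrum_nonneg (R := ℝ) x hsa,
    ← hsa.map_spectrum_real f hf]
  exact fun y hy => spectrum_nonneg_of_nonneg hx hy

theorem ContinuousLinearMap.nonneg_iff_inner_nonneg {H : Type*} [NormedAddCommGroup H]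
    [InnerProductSpace ℂ H] [CompleteSpace H] {T : H →L[ℂ] H} :
    0 ≤ T ↔ ∀ x, 0 ≤ ⟪x, T x⟫_ℂ := by
  rw [ContinuousLinearMap.nonneg_iff_isPositive]
  refine ⟨fun h x => h.inner_nonneg_right x, fun h => ?_⟩
  rw [ContinuousLinearMap.isPositive_iff_complex]
  intro x
  have hx := h x
  rw [← inner_conj_symm, ← Complex.star_def, star_nonneg_iff] at hx
  obtain ⟨h1, h2⟩ := Complex.nonneg_iff.mp hx
  exact ⟨Complex.ext (by simp) (by simpa using h2), h1⟩

section Matrix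

variable {B K : Type*} [CStarAlgebra B] [NormedAddCommGroup K] [InnerProductSpace ℂ K]
  [CompleteSpace K] {n : ℕ}

/-- The operator on `Kⁿ` given by the entries of `ρ(M)`. -/
def matrixOp (ρ : B →⋆ₐ[ℂ] (K →L[ℂ] K)) (M : CStarMatrix (Fin n) (Fin n) B) :
    PiLp 2 (fun _ : Fin n => K) →L[ℂ] PiLp 2 (fun _ : Fin n => K) :=
  ((PiLp.continuousLinearEquiv 2 ℂ (fun _ : Fin n => K)).symm :
      (Fin n → K) →L[ℂ] PiLp 2 (fun _ : Fin n => K)) ∘L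
    ContinuousLinearMap.pi fun j => ∑ k, ρ (M j k) ∘L PiLp.proj 2 (fun _ : Fin n => K) k

theorem matrixOp_apply (ρ : B →⋆ₐ[ℂ] (K →L[ℂ] K)) (M : CStarMatrix (Fin n) (Fin n) B)
    (ξ : PiLp 2 (fun _ : Fin n => K)) (j : Fin n) :
    matrixOp ρ M ξ j = ∑ k, ρ (M j k) (ξ k) := by
  simp [matrixOp]

/-- The amplification of a representation to matrices. -/
def matrixRep (ρ : B →⋆ₐ[ℂ] (K →L[ℂ] K)) : CStarMatrix (Fin n) (Fin n) B →⋆ₐ[ℂ]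
    (PiLp 2 (fun _ : Fin n => K) →L[ℂ] PiLp 2 (fun _ : Fin n => K)) where
  toFun := matrixOp ρ
  map_one' := by
    ext ξ j
    rw [matrixOp_apply, Finset.sum_eq_single j]
    · simp
    · intro k _ hk
      simp [CStarMatrix.one_apply_ne hk.symm]
    · simp
  map_mul' M N := by
    ext ξ j
    simp only [matrixOp_apply, CStarMatrix.mul_apply, mul_apply_eq_comp, map_sum, map_mul,
      sum_apply]
    exact Finset.sum_comm
  map_zero' := by ext ξ j; simp [matrixOp_apply]
  map_add' M N := by ext ξ j; simp [matrixOp_apply, Finset.sum_add_distrib]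
  commutes' c := by
    ext ξ j
    rw [Algebra.algebraMap_eq_smul_one, matrixOp_apply, Finset.sum_eq_single j]
    · simp [Algebra.algebraMap_eq_smul_one]
    · intro k _ hk
      simp [CStarMatrix.one_apply_ne hk.symm]
    · simp
  map_star' M := by
    refine (ContinuousLinearMap.eq_adjoint_iff _ _).mpr fun ξ η => ?_
    simp only [PiLp.inner_apply, matrixOp_apply, sum_inner, inner_sum, CStarMatrix.star_apply,
      map_star, ContinuousLinearMap.star_eq_adjoint, ContinuousLinearMap.adjoint_inner_left]
    exact Finset.sum_comm

theorem matrixRep_apply (ρ : B →⋆ₐ[ℂ] (K →L[ℂ] K)) (M : CStarMatrix (Fin n) (Fin n) B)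
    (ξ : PiLp 2 (fun _ : Fin n => K)) (j : Fin n) :
    matrixRep ρ M ξ j = ∑ k, ρ (M j k) (ξ k) := matrixOp_apply ρ M ξ j

theorem matrixRep_injective {ρ : B →⋆ₐ[ℂ] (K →L[ℂ] K)} (hρ : Function.Injective ρ) :
    Function.Injective (matrixRep (n := n) ρ) := by
  rw [injective_iff_map_eq_zero]
  intro M hM
  ext j k
  refine hρ ?_
  ext x
  have h := congrArg (fun T => T (PiLp.single 2 k x) j) hM
  simp only [matrixRep_apply] at h
  rw [Finset.sum_eq_single k] at h
  · simpa using h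
  · intro l _ hl
    simp [hl]
  · simp

end Matrix

/-! ### Changing the representation of the second factor -/

section Transfer

variable {A B H K : Type*} [CStarAlgebra A] [CStarAlgebra B]
  [NormedAddCommGroup H] [InnerProductSpace ℂ H] [CompleteSpace H]
  [NormedAddCommGroup K] [InnerProductSpace ℂ K] [CompleteSpace K] {n : ℕ}

/-- The matrix with entries `(ω_{jk} ⊗ id) x`, where `ω_{jk} a = ⟪h j, π a (h k)⟫`. -/
def compression (π : A →⋆ₐ[ℂ] (H →L[ℂ] H)) (h : Fin n → H) :
    A ⊗[ℂ] B →ₗ[ℂ] CStarMatrix (Fin n) (Fin n) B :=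
  TensorProduct.lift <| LinearMap.mk₂ ℂ
    (fun a b => CStarMatrix.ofMatrix (Matrix.of fun j k => ⟪h j, π a (h k)⟫_ℂ • b))
    (fun a a' b => by ext; simp [add_smul])
    (fun c a b => by ext; simp [mul_smul])
    (fun a b b' => by ext; simp)
    (fun c a b => by ext; simp [smul_comm c])

theorem compression_tmul_apply (π : A →⋆ₐ[ℂ] (H →L[ℂ] H)) (h : Fin n → H) (a : A) (b : B)
    (j k : Fin n) : compression π h (a ⊗ₜ[ℂ] b) j k = ⟪h j, π a (h k)⟫_ℂ • b := rfl

/-- The quadratic form at a finite tensor sees `x` only through a matrix over `B` that does not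
depend on `ρ`. -/
theorem inner_tensorRep (π : A →⋆ₐ[ℂ] (H →L[ℂ] H)) (ρ : B →⋆ₐ[ℂ] (K →L[ℂ] K)) (h : Fin n → H)
    (ξ : PiLp 2 (fun _ : Fin n => K)) (x : A ⊗[ℂ] B) :
    ⟪HilbertTensor.of (∑ j, h j ⊗ₜ[ℂ] ξ j),
      tensorRep π ρ x (HilbertTensor.of (∑ j, h j ⊗ₜ[ℂ] ξ j))⟫_ℂ =
      ⟪ξ, matrixRep ρ (compression π h x) ξ⟫_ℂ := by
  induction x with
  | zero => simp
  | add x y hx hy =>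
    simp only [map_add, add_apply, inner_add_right] at hx hy ⊢
    rw [hx, hy]
  | tmul a b =>
    simp only [tensorRep_tmul, map_sum, tensorOp_of, sum_inner, inner_sum, HilbertTensor.inner_of,
      PiLp.inner_apply, matrixRep_apply, compression_tmul_apply, map_smul, smul_apply,
      inner_smul_right]
    exact Finset.sum_comm

/-- Positivity of the image of an element of the algebraic tensor product does not depend on the
choice of a faithful representation of the second factor. -/
theorem tensorRep_nonneg_of_injective {K' : Type*} [NormedAddCommGroup K'] [InnerProductSpace ℂ K']
    [CompleteSpace K'] (π : A →⋆ₐ[ℂ] (H →L[ℂ] H)) {ρ : B →⋆ₐ[ℂ] (K →L[ℂ] K)}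
    (hρ : Function.Injective ρ) (σ : B →⋆ₐ[ℂ] (K' →L[ℂ] K')) {x : A ⊗[ℂ] B}
    (hx : 0 ≤ tensorRep π ρ x) : 0 ≤ tensorRep π σ x := by
  rw [ContinuousLinearMap.nonneg_iff_inner_nonneg]
  have hclosed : IsClosed {z | 0 ≤ ⟪z, tensorRep π σ x z⟫_ℂ} :=
    isClosed_le continuous_const (by fun_prop)
  intro z
  refine HilbertTensor.denseRange_of.induction_on (p := fun z => 0 ≤ ⟪z, tensorRep π σ x z⟫_ℂ) z
    hclosed fun t => ?_
  obtain ⟨n, h, ξ, rfl⟩ := TensorProduct.exists_sum_tmul_eq t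
  let : PartialOrder B := CStarAlgebra.spectralOrder B
  have : StarOrderedRing B := CStarAlgebra.spectralOrderedRing B
  -- With `h` fixed, all choices of `η` test the matrix in the faithful amplification of `ρ`; its
  -- positivity then passes to every `σ`.
  have hM : 0 ≤ compression π h x := by
    refine (matrixRep (n := n) ρ).nonneg_of_map_nonneg (matrixRep_injective hρ) ?_
    rw [ContinuousLinearMap.nonneg_iff_inner_nonneg]
    intro η
    rw [← inner_tensorRep]
    exact ContinuousLinearMap.nonneg_iff_inner_nonneg.mp hx _
  have := ContinuousLinearMap.nonneg_iff_inner_nonneg.mp (map_nonneg (matrixRep (n := n) σ) hM)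
    (WithLp.toLp 2 ξ)
  rwa [← inner_tensorRep] at this

end Transfer

/-! ### Faithfulness and nontriviality of the universal representation -/

section Universal

variable {A : Type*} [CStarAlgebra A] [PartialOrder A] [StarOrderedRing A]

/-- Evaluate at the class of `1` in the summand of `φ`: its image under `a` has squared norm
`φ(a*a)`. -/
theorem state_star_mul_self_eq_zero {a : A} (ha : universalRep A a = 0) (φ : CStarState A) :
    φ.1 (star a * a) = 0 := by
  classical
  set v : φ.1.GNS := ((φ.1.toPreGNS 1 : φ.1.PreGNS) : φ.1.GNS) with hv
  have h : φ.1.gnsStarAlgHom a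
      (lp.single (E := fun φ : CStarState A => φ.1.GNS) 2 φ v φ) = 0 :=
    congrArg (fun T => T (lp.single (E := fun φ : CStarState A => φ.1.GNS) 2 φ v) φ) ha
  rw [lp.single_apply_self] at h
  have h1 : ((φ.1.leftMulMapPreGNS a (φ.1.toPreGNS 1) : φ.1.PreGNS) : φ.1.GNS) = 0 := by
    rw [← φ.1.gnsNonUnitalStarAlgHom_apply_coe]
    exact h
  have h2 : ‖φ.1.toPreGNS (a * 1)‖ = 0 := by
    rw [← UniformSpace.Completion.norm_coe]
    exact norm_eq_zero.mpr h1
  have h3 := φ.1.preGNS_norm_sq (φ.1.toPreGNS (a * 1))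
  rw [h2] at h3
  simpa using h3.symm

/-- The vector state of a representation. -/
def vectorState {K : Type*} [NormedAddCommGroup K] [InnerProductSpace ℂ K] [CompleteSpace K]
    (ρ : A →⋆ₐ[ℂ] (K →L[ℂ] K)) (ξ : K) (hξ : ‖ξ‖ = 1) : CStarState A :=
  ⟨PositiveLinearMap.mk₀ ((innerSL ℂ ξ).toLinearMap ∘ₗ
      (ContinuousLinearMap.apply ℂ K ξ).toLinearMap ∘ₗ ρ.toAlgHom.toLinearMap)
    (fun a ha => ContinuousLinearMap.nonneg_iff_inner_nonneg.mp (map_nonneg ρ ha) ξ), by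
    change ⟪ξ, ρ 1 ξ⟫_ℂ = 1
    rw [map_one, one_apply_eq_self, inner_self_eq_norm_sq_to_K, hξ]
    simp⟩

/-- The vector states of `ρ` occur among all states, and they detect every `ρ a ξ`. -/
theorem universalRep_injective_of_injective {K : Type*} [NormedAddCommGroup K]
    [InnerProductSpace ℂ K] [CompleteSpace K] {ρ : A →⋆ₐ[ℂ] (K →L[ℂ] K)}
    (hρ : Function.Injective ρ) : Function.Injective (universalRep A) := by
  rw [injective_iff_map_eq_zero]
  intro a ha
  refine hρ ?_
  rw [map_zero]
  have hunit : ∀ ξ : K, ‖ξ‖ = 1 → ρ a ξ = 0 := by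
    intro ξ hξ
    have h := state_star_mul_self_eq_zero ha (vectorState ρ ξ hξ)
    change ⟪ξ, ρ (star a * a) ξ⟫_ℂ = 0 at h
    rwa [map_mul, map_star, mul_apply_eq_comp, ContinuousLinearMap.star_eq_adjoint,
      ContinuousLinearMap.adjoint_inner_right, inner_self_eq_zero] at h
  ext ξ
  rcases eq_or_ne ξ 0 with rfl | hξ
  · simp
  · have h := hunit ((‖ξ‖⁻¹ : ℂ) • ξ) (by
      rw [norm_smul]; simp [hξ])
    rw [map_smul, smul_eq_zero] at h
    simpa [hξ] using h

instance [Nontrivial A] : Nontrivial (UniversalSpace A) := by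
  classical
  obtain ⟨φ⟩ := nonempty_state (A := A)
  refine ⟨lp.single 2 φ ((φ.1.toPreGNS 1 : φ.1.PreGNS) : φ.1.GNS), 0, fun h => ?_⟩
  have h1 := congrArg (fun ξ => ξ φ) h
  simp only [lp.single_apply_self, lp.coeFn_zero, Pi.zero_apply] at h1
  have h2 : ‖φ.1.toPreGNS 1‖ = 0 := by
    rw [← UniformSpace.Completion.norm_coe, h1, norm_zero]
  have h3 := φ.1.preGNS_norm_sq (φ.1.toPreGNS 1)
  rw [h2] at h3
  simp [φ.2] at h3

end Universal

/-! ### The regular representation, polar decomposition and transfer of invertibility -/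

section Reduced

variable (G : Type*) [Group G]

/-- The defining representation of the reduced group C⋆-algebra on `ℓ²(G)`. -/
def reducedRep : ReducedGroupCStar G →⋆ₐ[ℂ] (EllTwo G →L[ℂ] EllTwo G) :=
  (reducedSubalgebra G).subtype

theorem reducedRep_injective : Function.Injective (reducedRep G) := Subtype.val_injective

variable {G}

theorem exists_reducedRep_eq (g : G) : ∃ w : ReducedGroupCStar G, reducedRep G w = leftRegular g :=
  ⟨⟨leftRegular g, StarSubalgebra.le_topologicalClosure _
    (StarAlgebra.subset_adjoin ℂ _ ⟨g, rfl⟩)⟩, rfl⟩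

end Reduced

/-- A left invertible element of a C⋆-algebra that is not invertible yields a non-unitary
isometry, by polar decomposition. -/
theorem exists_isometry_of_leftInvertible {C : Type*} [CStarAlgebra C] {T L : C} (hL : L * T = 1)
    (hT : ¬ IsUnit T) : ∃ v : C, star v * v = 1 ∧ v * star v ≠ 1 := by
  let : PartialOrder C := CStarAlgebra.spectralOrder C
  have : StarOrderedRing C := CStarAlgebra.spectralOrderedRing C
  obtain ⟨δ, hδ, hle⟩ := exists_algebraMap_le_of_mul_eq_one hL
  have hδ0 : IsStrictlyPositive (algebraMap ℝ C δ) :=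
    ((IsUnit.mk0 δ hδ.ne').map (algebraMap ℝ C)).isStrictlyPositive (algebraMap_nonneg C hδ.le)
  have hpos : IsStrictlyPositive (star T * T) := hδ0.of_le hle
  set h : C := (star T * T) ^ (-(1 / 2) : ℝ) with hh
  have hhs : star h = h := (IsSelfAdjoint.of_nonneg CFC.rpow_nonneg).star_eq
  have hmain : h * (star T * T) * h = 1 := CFC.conjugate_rpow_neg_one_half (star T * T) hpos
  refine ⟨T * h, by rw [star_mul, hhs, ← hmain]; simp only [mul_assoc], fun hv => hT ?_⟩
  have hr : T * (h * star (T * h)) = 1 := by rw [← mul_assoc]; exact hv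
  exact ⟨⟨T, L, by rw [left_inv_eq_right_inv hL hr]; exact hr, hL⟩, rfl⟩

theorem isUnit_of_mul_eq_one_of_star_mul_eq_one {C : Type*} [CStarAlgebra C] {T L M : C}
    (hL : L * T = 1) (hM : M * star T = 1) : IsUnit T := by
  have hr : T * star M = 1 := by simpa using congrArg star hM
  exact ⟨⟨T, L, by rw [left_inv_eq_right_inv hL hr]; exact hr, hL⟩, rfl⟩

section RepresentationIndependence

variable {A B H K K' : Type*} [CStarAlgebra A] [CStarAlgebra B]
  [NormedAddCommGroup H] [InnerProductSpace ℂ H] [CompleteSpace H]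
  [NormedAddCommGroup K] [InnerProductSpace ℂ K] [CompleteSpace K]
  [NormedAddCommGroup K'] [InnerProductSpace ℂ K'] [CompleteSpace K']

/-- Left invertibility of the image of an element of the algebraic tensor product does not depend
on the choice of a faithful representation of the second factor. -/
theorem tensorRep_leftInvertible_of_injective (π : A →⋆ₐ[ℂ] (H →L[ℂ] H))
    {ρ : B →⋆ₐ[ℂ] (K →L[ℂ] K)} (hρ : Function.Injective ρ) (σ : B →⋆ₐ[ℂ] (K' →L[ℂ] K'))
    {t : A ⊗[ℂ] B} (ht : ∃ L, L * tensorRep π ρ t = 1) : ∃ L, L * tensorRep π σ t = 1 := by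
  obtain ⟨L, hL⟩ := ht
  obtain ⟨δ, hδ, hle⟩ := exists_algebraMap_le_of_mul_eq_one hL
  -- The lower bound is stated for an element of the algebraic tensor product, so that positivity
  -- can be transferred.
  have h1 : 0 ≤ tensorRep π ρ (star t * t - (δ : ℂ) • 1) := by
    rw [map_sub, map_mul, map_star, map_smul, map_one, Complex.coe_smul,
      ← Algebra.algebraMap_eq_smul_one]
    exact sub_nonneg.mpr hle
  have h2 := tensorRep_nonneg_of_injective π hρ σ h1
  rw [map_sub, map_mul, map_star, map_smul, map_one, Complex.coe_smul,
      ← Algebra.algebraMap_eq_smul_one, sub_nonneg] at h2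
  obtain ⟨L', hL', -⟩ := exists_mul_eq_one_of_algebraMap_le hδ h2
  exact ⟨L', hL'⟩

/-- Invertibility of the image of an element of the algebraic tensor product does not depend
on the choice of a faithful representation of the second factor. -/
theorem tensorRep_isUnit_of_injective (π : A →⋆ₐ[ℂ] (H →L[ℂ] H))
    {ρ : B →⋆ₐ[ℂ] (K →L[ℂ] K)} (hρ : Function.Injective ρ) (σ : B →⋆ₐ[ℂ] (K' →L[ℂ] K'))
    {t : A ⊗[ℂ] B} (ht : IsUnit (tensorRep π ρ t)) : IsUnit (tensorRep π σ t) := by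
  obtain ⟨u, hu⟩ := ht
  obtain ⟨L, hL⟩ := tensorRep_leftInvertible_of_injective π hρ σ (t := t)
    ⟨((u⁻¹ : Units _) : _ →L[ℂ] _), by rw [← hu, Units.inv_mul]⟩
  -- Left invertibility of the adjoint supplies the right inverse.
  obtain ⟨M, hM⟩ := tensorRep_leftInvertible_of_injective π hρ σ (t := star t)
    ⟨star ((u⁻¹ : Units _) : _ →L[ℂ] _), by
      rw [map_star, ← hu, ← star_mul, Units.mul_inv, star_one]⟩
  rw [map_star] at hM
  exact isUnit_of_mul_eq_one_of_star_mul_eq_one hL hM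

end RepresentationIndependence

/-- Left invertibility in a C⋆-subalgebra can be tested in the ambient algebra. -/
theorem StarAlgHom.exists_mul_eq_one_of_injective {C D : Type*} [CStarAlgebra C] [CStarAlgebra D]
    (f : C →⋆ₐ[ℂ] D) (hf : Function.Injective f) {T : C} {L : D} (hL : L * f T = 1) :
    ∃ M : C, M * T = 1 := by
  let : PartialOrder C := CStarAlgebra.spectralOrder C
  have : StarOrderedRing C := CStarAlgebra.spectralOrderedRing C
  let : PartialOrder D := CStarAlgebra.spectralOrder D
  have : StarOrderedRing D := CStarAlgebra.spectralOrderedRing D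
  obtain ⟨δ, hδ, hle⟩ := exists_algebraMap_le_of_mul_eq_one hL
  have h1 : 0 ≤ f (star T * T - (δ : ℂ) • 1) := by
    rw [map_sub, map_mul, map_star, map_smul, map_one, Complex.coe_smul,
      ← Algebra.algebraMap_eq_smul_one]
    exact sub_nonneg.mpr hle
  have h2 := f.nonneg_of_map_nonneg hf h1
  rw [Complex.coe_smul, ← Algebra.algebraMap_eq_smul_one, sub_nonneg] at h2
  obtain ⟨M, hM, -⟩ := exists_mul_eq_one_of_algebraMap_le hδ h2
  exact ⟨M, hM⟩

theorem StarAlgHom.algebraMap_real_le {C D : Type*} [CStarAlgebra C] [PartialOrder C]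
    [StarOrderedRing C] [CStarAlgebra D] [PartialOrder D] [StarOrderedRing D] (f : C →⋆ₐ[ℂ] D)
    {r : ℝ} {x : C} (h : algebraMap ℝ C r ≤ x) : algebraMap ℝ D r ≤ f x := by
  refine le_of_eq_of_le ?_ (OrderHomClass.mono f h)
  rw [Algebra.algebraMap_eq_smul_one, Algebra.algebraMap_eq_smul_one, ← Complex.coe_smul,
    ← Complex.coe_smul, map_smul, map_one]

theorem exists_tensorRep_leftInvertible {A : Type*} [CStarAlgebra A] [PartialOrder A]
    [StarOrderedRing A] (hA : ¬ ∃ τ : CStarState A, τ.IsTracial) {H : Type*}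
    [NormedAddCommGroup H] [InnerProductSpace ℂ H] [CompleteSpace H] [Nontrivial H]
    (π : A →⋆ₐ[ℂ] (H →L[ℂ] H)) :
    ∃ t : A ⊗[ℂ] ReducedGroupCStar (FreeGroup ℕ),
      (∃ L, L * tensorRep π (reducedRep (FreeGroup ℕ)) t = 1) ∧
        ¬ IsUnit (tensorRep π (reducedRep (FreeGroup ℕ)) t) := by
  obtain ⟨n, a, r, hr, h1, h2⟩ := exists_sum_mul_star_eq_one hA
  have h1' : ∑ i, π (a i) * star (π (a i)) = 1 := by
    simpa only [map_sum, map_mul, map_star, map_one] using congrArg π h1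
  have h2' := π.algebraMap_real_le h2
  simp only [map_sum, map_mul, map_star] at h2'
  obtain ⟨N, e, T, hT, hL⟩ := exists_leftInvertible_sum_tensorOp (fun i => π (a i)) hr h1' h2'
  choose w hw using fun i : ℕ => exists_reducedRep_eq (FreeGroup.of i)
  refine ⟨∑ j, a j.1 ⊗ₜ[ℂ] w (e j), ?_⟩
  have htT : tensorRep π (reducedRep (FreeGroup ℕ)) (∑ j, a j.1 ⊗ₜ[ℂ] w (e j)) = T := by
    rw [hT, map_sum]
    exact Finset.sum_congr rfl fun j _ => by rw [tensorRep_tmul, hw]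
  rwa [htT]

/-! ### Conclusion in the minimal tensor product -/

section MinTensor

variable (A B : Type*) [CStarAlgebra A] [PartialOrder A] [StarOrderedRing A]
  [CStarAlgebra B] [PartialOrder B] [StarOrderedRing B]

/-- The defining representation of the spatial tensor product. -/
def minTensorRep : MinTensor A B →⋆ₐ[ℂ] (HilbertTensor (UniversalSpace A) (UniversalSpace B) →L[ℂ]
    HilbertTensor (UniversalSpace A) (UniversalSpace B)) :=
  (spatialTensor (universalRep A) (universalRep B)).subtype

theorem minTensorRep_injective : Function.Injective (minTensorRep A B) := Subtype.val_injective

variable {A B}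

theorem exists_minTensorRep_eq (t : A ⊗[ℂ] B) :
    ∃ T : MinTensor A B, minTensorRep A B T = tensorRep (universalRep A) (universalRep B) t :=
  ⟨⟨_, tensorRep_mem_spatialTensor _ _ t⟩, rfl⟩

/-- If the image of an element of the algebraic tensor product in some spatial representation is
left invertible but not invertible, then the minimal tensor product contains a non-unitary
isometry. -/
theorem exists_isometry_minTensor {K : Type*} [NormedAddCommGroup K] [InnerProductSpace ℂ K]
    [CompleteSpace K] {ρ : B →⋆ₐ[ℂ] (K →L[ℂ] K)} (hρ : Function.Injective ρ) {t : A ⊗[ℂ] B}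
    (hL : ∃ L, L * tensorRep (universalRep A) ρ t = 1)
    (hunit : ¬ IsUnit (tensorRep (universalRep A) ρ t)) :
    ∃ v : MinTensor A B, star v * v = 1 ∧ v * star v ≠ 1 := by
  have hB := universalRep_injective_of_injective hρ
  obtain ⟨T, hT⟩ := exists_minTensorRep_eq t
  obtain ⟨L, hLT⟩ := tensorRep_leftInvertible_of_injective (universalRep A) hρ
    (universalRep B) hL
  rw [← hT] at hLT
  obtain ⟨M, hM⟩ := (minTensorRep _ _).exists_mul_eq_one_of_injective
    (minTensorRep_injective _ _) hLT
  -- Non-invertibility travels the other way: a unit in `MinTensor` is a unit on the universal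
  -- space, and faithfulness `hB` carries invertibility back to `ρ`.
  refine exists_isometry_of_leftInvertible hM fun hu => hunit ?_
  refine tensorRep_isUnit_of_injective (universalRep A) hB _ ?_
  rw [← hT]
  exact hu.map (minTensorRep _ _)

end MinTensor

end

theorem theorem2p4 (A : Type*) [CStarAlgebra A] [PartialOrder A] [StarOrderedRing A]
    [Nontrivial A] (hA : ¬ ∃ τ : CStarState A, τ.IsTracial) :
    ∃ v : MinTensor A (ReducedGroupCStar (FreeGroup ℕ)), star v * v = 1 ∧ v * star v ≠ 1 := by
  obtain ⟨t, hL, hunit⟩ := exists_tensorRep_leftInvertible hA (universalRep A)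
  exact exists_isometry_minTensor (reducedRep_injective _) hL hunit
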